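/- \textbf{Lemma.} For every constant $\theta\in(0,1)$ there is a constant $c>0$, depending only on $\theta$, such that the following holds. Let $X$ be a set of $n$ points in the plane, no three of them collinear, let $t\ge 0$ be an integer with $t\le n/2$, and let $\epsilon>0$. Let $S$ be a uniformly random subset of $X$ of size $|S|=\min(n,\lceil c\,\epsilon^{-2}\log n\rceil)$, and suppose that $t'=\left(\frac tn+\theta\epsilon-\frac{\theta\epsilon t}{n}\right)|S|$ is an integer. Then, with probability at least $1-3/n$, a rectangle of minimum area among all closed rectangles (of arbitrary orientation, segments and points being counted as rectangles of area $0$) that contain at least $|S|-t'$ points of $S$ exists, and every such minimum-area rectangle $P$ satisfies $$(n-t)(1-\epsilon)\le |P\cap X|\le n-t+1 .$$ -/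

import Mathlib

open scoped RealInnerProductSpace

/-- The Euclidean plane. -/
abbrev Plane : Type := EuclideanSpace ℝ (Fin 2)

/-- A closed rectangle of arbitrary orientation in the plane, given by a corner, the unit directions
of two perpendicular sides and the lengths of these sides. Side lengths may be zero, so that segments
and points are (degenerate) rectangles of area zero; without them an area-minimal rectangle
covering at most two points would not exist. -/
structure PlaneRectangle where
  corner : Plane
  dir₁ : Plane
  dir₂ : Plane
  norm_dir₁ : ‖dir₁‖ = 1
  norm_dir₂ : ‖dir₂‖ = 1
  inner_dir : ⟪dir₁, dir₂⟫ = 0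
  width : ℝ
  height : ℝ
  width_nonneg : 0 ≤ width
  height_nonneg : 0 ≤ height

namespace PlaneRectangle

/-- The points of the rectangle, with its boundary. -/
def carrier (R : PlaneRectangle) : Set Plane :=
  {p | ∃ x ∈ Set.Icc (0 : ℝ) R.width, ∃ y ∈ Set.Icc (0 : ℝ) R.height,
    p = R.corner + x • R.dir₁ + y • R.dir₂}

/-- The area of the rectangle. -/
def area (R : PlaneRectangle) : ℝ := R.width * R.height

open Classical in
/-- The number of points of `X` that the rectangle encloses. -/
noncomputable def enclosed (R : PlaneRectangle) (X : Finset Plane) : ℕ :=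
  (X.filter (fun p => p ∈ R.carrier)).card

/-- The rectangle covers all points of `X` except at most `t` outliers. -/
def Covers (R : PlaneRectangle) (X : Finset Plane) (t : ℕ) : Prop :=
  X.card ≤ R.enclosed X + t

/-- The rectangle is a minimum enclosing rectangle of `X` with `t` outliers: it has the least area
among the rectangles that cover at least `|X| - t` points of `X`. -/
def IsOptimal (R : PlaneRectangle) (X : Finset Plane) (t : ℕ) : Prop :=
  R.Covers X t ∧ ∀ R' : PlaneRectangle, R'.Covers X t → R.area ≤ R'.area

end PlaneRectangle

/-- No three distinct points of `X` lie on a line. -/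
def NoThreeCollinear (X : Finset Plane) : Prop :=
  ∀ p ∈ X, ∀ q ∈ X, ∀ r ∈ X, p ≠ q → p ≠ r → q ≠ r → ¬ Collinear ℝ ({p, q, r} : Set Plane)

/-- The sample size `min (n, c ε⁻² log n)`, rounded up to an integer. -/
noncomputable def sampleSize (c ε : ℝ) (n : ℕ) : ℕ :=
  min n ⌈c * (ε ^ 2)⁻¹ * Real.log n⌉₊

open Classical in
/-- The probability that a uniformly random `s`-element subset of `X`
(sampling without replacement) has the property `E`. -/
noncomputable def sampleProb {α : Type*} (X : Finset α) (s : ℕ) (E : Finset α → Prop) : ℝ :=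
  (((X.powersetCard s).filter E).card : ℝ) / ((X.powersetCard s).card : ℝ)

/-! With high probability the sample is a relative approximation of `X` for all rectangles at once:
each rectangle contains nearly the same fraction of `S` as of `X`, up to an additive error `κ * ε`.
Two facts give this. For one fixed subset of `X`, the count in `S` is hypergeometric and its tail is
at most the Chernoff-type bound `card_upper_tail_le`. Rectangles cut out at most `|X| ^ 16` subsets,
since a rectangle is an intersection of four half-planes and half-planes shatter no four points
(`card_traces_le`). The union bound is `le_sampleProb_of_approximation`.

The rest is deterministic. An optimal rectangle contains at least `|S| - t'` sample points. If its
area is positive it contains at most one more: points on one side are collinear, so there are at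
most two, and a surplus of two would allow that side to be moved inwards
(`IsOptimal.enclosed_add_le`). Its sample fraction is thus nearly `(1 - t/n) * (1 - θ * ε)`. The gap
to `(1 - t/n) * (1 - ε)` below and to `1 - t/n` above absorbs the approximation error
(`IsOptimal.enclosed_bounds`). Existence of an optimum is compactness (`exists_isOptimal`). -/

/-! ### Tail bound for the hypergeometric distribution -/

theorem card_supersets_le {α : Type*} [DecidableEq α] (X J : Finset α) (s : ℕ) (hJ : J ⊆ X) :
    (((X.powersetCard s).filter (fun S => J ⊆ S)).card : ℝ) * X.card.choose J.card
      ≤ X.card.choose s * s.choose J.card := by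
  by_cases hjs : J.card ≤ s
  · have h1 : ((X.powersetCard s).filter (fun S => J ⊆ S)).card
        = (X.card - J.card).choose (s - J.card) := Finset.card_filter_powersetCard_subset _ _ _ hJ hjs
    by_cases hsn : s ≤ X.card
    · have h2 := Nat.choose_mul (n := X.card) (k := s) (s := J.card) hjs
      have h3 : ((X.powersetCard s).filter (fun S => J ⊆ S)).card * X.card.choose J.card
          ≤ X.card.choose s * s.choose J.card := by
        rw [h2, mul_comm]
        exact Nat.mul_le_mul_left _ h1.le
      exact_mod_cast h3
    · rw [Finset.powersetCard_eq_empty.2 (by omega)]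
      simp only [Finset.filter_empty, Finset.card_empty, Nat.cast_zero, zero_mul]
      positivity
  · have : (X.powersetCard s).filter (fun S => J ⊆ S) = ∅ := by
      rw [Finset.filter_eq_empty_iff]
      intro S hS hJS
      rw [Finset.mem_powersetCard] at hS
      have := Finset.card_le_card hJS
      omega
    rw [this]
    simp only [Finset.card_empty, Nat.cast_zero, zero_mul]
    positivity

/-- Factor by factor, `(a - i) / (n - i) ≤ a / n`. Truncated subtraction keeps the cross-multiplied
form true for every index. -/
theorem descFactorial_mul_pow_le {a n : ℕ} (h : a ≤ n) (j : ℕ) :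
    a.descFactorial j * n ^ j ≤ n.descFactorial j * a ^ j := by
  induction j with
  | zero => simp
  | succ j ih =>
    rw [Nat.descFactorial_succ, Nat.descFactorial_succ, pow_succ, pow_succ]
    have h1 : (a - j) * n ≤ (n - j) * a := by
      rw [Nat.sub_mul, Nat.sub_mul, mul_comm n a]
      exact Nat.sub_le_sub_left (Nat.mul_le_mul_left j h) _
    calc (a - j) * a.descFactorial j * (n ^ j * n)
        = ((a - j) * n) * (a.descFactorial j * n ^ j) := by ring
      _ ≤ ((n - j) * a) * (n.descFactorial j * a ^ j) := Nat.mul_le_mul h1 ih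
      _ = _ := by ring

theorem choose_le_choose_mul_div_pow {a n : ℕ} (h : a ≤ n) (hn : 0 < n) (j : ℕ) :
    (a.choose j : ℝ) ≤ n.choose j * ((a : ℝ) / n) ^ j := by
  have h1 := descFactorial_mul_pow_le h j
  rw [Nat.descFactorial_eq_factorial_mul_choose, Nat.descFactorial_eq_factorial_mul_choose,
    mul_assoc, mul_assoc] at h1
  have h2 : a.choose j * n ^ j ≤ n.choose j * a ^ j :=
    Nat.le_of_mul_le_mul_left h1 (Nat.factorial_pos j)
  have h3 : (a.choose j : ℝ) * n ^ j ≤ n.choose j * a ^ j := by exact_mod_cast h2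
  rw [div_pow, ← mul_div_assoc, le_div_iff₀ (by positivity)]
  exact h3

/-- The cut-off `m` is arbitrary because the sum to be bounded runs up to the size of a set
unrelated to `s`; terms beyond `s` vanish. -/
theorem sum_choose_mul_pow_le (s m : ℕ) {z : ℝ} (hz : 0 ≤ z) :
    ∑ j ∈ Finset.range m, (s.choose j : ℝ) * z ^ j ≤ (1 + z) ^ s := by
  have h1 : (1 + z) ^ s = ∑ j ∈ Finset.range (s + 1 + m), (s.choose j : ℝ) * z ^ j := by
    rw [add_comm 1 z, add_pow]
    rw [← Finset.sum_subset (Finset.range_mono (Nat.le_add_right (s + 1) m))]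
    · exact Finset.sum_congr rfl fun j _ => by simp; ring
    · intro j _ hj
      rw [Finset.mem_range, not_lt] at hj
      rw [Nat.choose_eq_zero_of_lt (by omega)]
      simp
  rw [h1]
  exact Finset.sum_le_sum_of_subset_of_nonneg (Finset.range_mono (by omega))
    fun j _ _ => by positivity

/-- The generating function of a hypergeometric variable is dominated by that of the binomial
variable of the same mean. -/
theorem sum_pow_card_inter_le {α : Type*} [DecidableEq α] (X A : Finset α) (s : ℕ) (hA : A ⊆ X)
    (hX : 0 < X.card) {y : ℝ} (hy : 0 ≤ y) :
    ∑ S ∈ X.powersetCard s, (1 + y) ^ (S ∩ A).card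
      ≤ X.card.choose s * (1 + y * ((A.card : ℝ) / X.card)) ^ s := by
  -- Expanding over subsets `J` of `S ∩ A` and exchanging sums reduces the claim to counting the
  -- samples that contain a given `J`.
  have hexp : ∀ S : Finset α, (1 + y) ^ (S ∩ A).card
      = ∑ J ∈ A.powerset, if J ⊆ S then y ^ J.card else 0 := by
    intro S
    rw [← Finset.sum_filter, add_comm 1 y, ← Finset.sum_pow_mul_eq_add_pow]
    simp only [one_pow, mul_one]
    refine Finset.sum_congr ?_ fun _ _ => rfl
    ext J
    simp only [Finset.mem_powerset, Finset.mem_filter, Finset.subset_inter_iff]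
    tauto
  simp_rw [hexp]
  rw [Finset.sum_comm]
  have hJ : ∀ J ∈ A.powerset, (∑ S ∈ X.powersetCard s, if J ⊆ S then y ^ J.card else 0)
      ≤ X.card.choose s * s.choose J.card / X.card.choose J.card * y ^ J.card := by
    intro J hJ
    have hJX : J ⊆ X := (Finset.mem_powerset.1 hJ).trans hA
    rw [← Finset.sum_filter, Finset.sum_const, nsmul_eq_mul]
    refine mul_le_mul_of_nonneg_right ?_ (by positivity)
    have : 0 < X.card.choose J.card := Nat.choose_pos (Finset.card_le_card hJX)
    rw [le_div_iff₀ (by positivity)]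
    exact card_supersets_le X J s hJX
  refine (Finset.sum_le_sum hJ).trans ?_
  rw [Finset.sum_powerset_apply_card
    (fun j => (X.card.choose s : ℝ) * s.choose j / X.card.choose j * y ^ j)]
  have hj : ∀ j ∈ Finset.range (A.card + 1),
      A.card.choose j • ((X.card.choose s : ℝ) * s.choose j / X.card.choose j * y ^ j)
      ≤ X.card.choose s * (s.choose j * (y * ((A.card : ℝ) / X.card)) ^ j) := by
    intro j hj
    have hAX := Finset.card_le_card hA
    have hpos : 0 < X.card.choose j :=
      Nat.choose_pos ((Nat.lt_succ_iff.1 (Finset.mem_range.1 hj)).trans hAX)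
    have h1 : (A.card.choose j : ℝ) / X.card.choose j ≤ ((A.card : ℝ) / X.card) ^ j := by
      rw [div_le_iff₀ (by positivity), mul_comm]
      exact choose_le_choose_mul_div_pow hAX hX j
    rw [nsmul_eq_mul, mul_pow]
    calc _ = (X.card.choose s : ℝ) * s.choose j * y ^ j
          * ((A.card.choose j : ℝ) / X.card.choose j) := by ring
      _ ≤ (X.card.choose s : ℝ) * s.choose j * y ^ j * ((A.card : ℝ) / X.card) ^ j := by gcongr
      _ = _ := by ring
  refine (Finset.sum_le_sum hj).trans ?_
  rw [← Finset.mul_sum]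
  exact mul_le_mul_of_nonneg_left (sum_choose_mul_pow_le s _ (by positivity)) (by positivity)

/-- An upper tail bound for sampling without replacement. -/
theorem card_upper_tail_le {α : Type*} [DecidableEq α] (X A : Finset α) (s : ℕ) (hA : A ⊆ X)
    (hX : 0 < X.card) {δ : ℝ} (hδ : 0 ≤ δ) :
    (((X.powersetCard s).filter
        (fun S => ((A.card : ℝ) / X.card + δ) * s < ((S ∩ A).card : ℝ))).card : ℝ)
      ≤ X.card.choose s * Real.exp (-(δ ^ 2 * s / 4)) := by
  set p : ℝ := (A.card : ℝ) / X.card with hp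
  have hp0 : 0 ≤ p := by positivity
  have hp1 : p ≤ 1 := by
    rw [hp, div_le_one (by positivity)]
    exact_mod_cast Finset.card_le_card hA
  by_cases hδ2 : δ ≤ 2
  -- Exponential Markov inequality with parameter `l = δ / 2`, which minimises the exponent `s * (l
  -- ^ 2 - δ * l)`. The bound `exp l ≤ 1 + l + l ^ 2` needs `l ≤ 1`; for `δ > 2` the event is empty.
  · have hl : 0 ≤ δ / 2 := by positivity
    have he : 1 + p * (Real.exp (δ / 2) - 1) ≤ Real.exp (p * (δ / 2) + (δ / 2) ^ 2) := by
      have h1 := (abs_le.1 (Real.abs_exp_sub_one_sub_id_le (x := δ / 2)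
        (by rw [abs_of_nonneg hl]; linarith))).2
      have h2 := Real.add_one_le_exp (p * (δ / 2) + (δ / 2) ^ 2)
      have h3 : p * (Real.exp (δ / 2) - 1) ≤ p * (δ / 2 + (δ / 2) ^ 2) :=
        mul_le_mul_of_nonneg_left (by linarith) hp0
      have h4 : p * (δ / 2) ^ 2 ≤ 1 * (δ / 2) ^ 2 :=
        mul_le_mul_of_nonneg_right hp1 (by positivity)
      linarith
    have hy : 0 ≤ Real.exp (δ / 2) - 1 := by linarith [Real.one_le_exp hl]
    have hm := sum_pow_card_inter_le X A s hA hX hy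
    have hpow : ∀ k : ℕ, (1 + (Real.exp (δ / 2) - 1)) ^ k = Real.exp (k * (δ / 2)) := by
      intro k
      rw [add_sub_cancel, ← Real.exp_nat_mul]
    set F := (X.powersetCard s).filter (fun S => (p + δ) * s < ((S ∩ A).card : ℝ)) with hF
    have hlow : (F.card : ℝ) * Real.exp ((p + δ) * s * (δ / 2))
        ≤ ∑ S ∈ X.powersetCard s, (1 + (Real.exp (δ / 2) - 1)) ^ (S ∩ A).card := by
      calc (F.card : ℝ) * Real.exp ((p + δ) * s * (δ / 2))
          = ∑ S ∈ F, Real.exp ((p + δ) * s * (δ / 2)) := by rw [Finset.sum_const, nsmul_eq_mul]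
        _ ≤ ∑ S ∈ F, (1 + (Real.exp (δ / 2) - 1)) ^ (S ∩ A).card := by
          refine Finset.sum_le_sum fun S hS => ?_
          rw [hpow]
          exact Real.exp_le_exp.2
            (mul_le_mul_of_nonneg_right (Finset.mem_filter.1 hS).2.le hl)
        _ ≤ _ := Finset.sum_le_sum_of_subset_of_nonneg (Finset.filter_subset _ _)
          fun S _ _ => by rw [hpow]; positivity
    have hup : (1 + (Real.exp (δ / 2) - 1) * p) ^ s
        ≤ Real.exp (s * (p * (δ / 2) + (δ / 2) ^ 2)) := by
      rw [Real.exp_nat_mul, mul_comm _ p]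
      exact pow_le_pow_left₀ (by positivity) he s
    have hfin : (F.card : ℝ) * Real.exp ((p + δ) * s * (δ / 2))
        ≤ X.card.choose s * Real.exp (s * (p * (δ / 2) + (δ / 2) ^ 2)) :=
      hlow.trans (hm.trans (mul_le_mul_of_nonneg_left hup (by positivity)))
    rw [← le_div_iff₀ (Real.exp_pos _), mul_div_assoc, ← Real.exp_sub] at hfin
    rwa [show s * (p * (δ / 2) + (δ / 2) ^ 2) - (p + δ) * s * (δ / 2) = -(δ ^ 2 * s / 4) by ring]
      at hfin
  · have : (X.powersetCard s).filter (fun S => (p + δ) * s < ((S ∩ A).card : ℝ)) = ∅ := by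
      rw [Finset.filter_eq_empty_iff]
      intro S hS
      rw [not_lt, ← (Finset.mem_powersetCard.1 hS).2]
      have h1 : ((S ∩ A).card : ℝ) ≤ S.card := by
        exact_mod_cast Finset.card_le_card Finset.inter_subset_left
      have h2 : 1 * (S.card : ℝ) ≤ (p + δ) * S.card :=
        mul_le_mul_of_nonneg_right (by linarith) (by positivity)
      linarith
    rw [this, Finset.card_empty, Nat.cast_zero]
    positivity

/-! ### Counting the traces of half-planes -/

open Classical in
/-- The subsets of `X` cut out by closed half-planes. -/
noncomputable def halfPlaneTraces (X : Finset Plane) : Finset (Finset Plane) :=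
  X.powerset.filter (fun A => ∃ (v : Plane) (a : ℝ), A = X.filter (fun p => ⟪v, p⟫ ≤ a))

-- By Radon's theorem, four points of the plane split into two parts whose convex hulls meet, and no
-- half-plane can contain one part and miss the other.
open Classical in
theorem card_le_three_of_shatters {X T : Finset Plane} (h : (halfPlaneTraces X).Shatters T) :
    T.card ≤ 3 := by
  by_contra! hT
  have hdep : ¬ AffineIndependent ℝ ((↑) : T → Plane) := by
    intro hi
    have h1 := hi.card_le_finrank_succ
    have h2 : Module.finrank ℝ (vectorSpan ℝ (Set.range ((↑) : T → Plane))) ≤ 2 := by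
      simpa using Submodule.finrank_le (vectorSpan ℝ (Set.range ((↑) : T → Plane)))
    rw [Fintype.card_coe] at h1
    omega
  obtain ⟨I, z, hz1, hz2⟩ := Convex.radon_partition hdep
  obtain ⟨U, hU, hTU⟩ := h (t := T.filter (fun p => p ∈ ((↑) : T → Plane) '' I))
    (Finset.filter_subset _ _)
  obtain ⟨V, hV, hTV⟩ := h (Finset.Subset.refl T)
  obtain ⟨hUX, v, a, rfl⟩ := Finset.mem_filter.1 hU
  have hTX : T ⊆ X := by
    rw [Finset.inter_eq_left] at hTV
    exact hTV.trans (Finset.mem_powerset.1 (Finset.mem_filter.1 hV).1)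
  have key : ∀ p : T, ⟪v, (p : Plane)⟫ ≤ a ↔ p ∈ I := by
    intro p
    have := Finset.ext_iff.1 hTU p
    simpa [hTX p.2] using this
  have hlin : IsLinearMap ℝ (fun p : Plane => ⟪v, p⟫) :=
    ⟨fun _ _ => inner_add_right _ _ _, fun _ _ => inner_smul_right _ _ _⟩
  have h1 : z ∈ {p : Plane | ⟪v, p⟫ ≤ a} :=
    convexHull_min (by rintro _ ⟨p, hp, rfl⟩; exact (key p).2 hp)
      (convex_halfSpace_le hlin a) hz1
  have h2 : z ∈ {p : Plane | a < ⟪v, p⟫} :=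
    convexHull_min (by
      rintro _ ⟨p, hp, rfl⟩
      exact not_le.1 fun hle => hp ((key p).1 hle)) (convex_halfSpace_gt hlin a) hz2
  exact absurd (show ⟪v, z⟫ ≤ a from h1) (not_le.2 h2)

theorem card_subsets_le_three {α : Type*} [DecidableEq α] (X : Finset α) (hX : 4 ≤ X.card) :
    (X.powerset.filter (fun T => T.card ≤ 3)).card ≤ X.card ^ 4 := by
  have h1 : X.powerset.filter (fun T => T.card ≤ 3)
      ⊆ (Finset.range 4).biUnion (fun k => X.powersetCard k) := by
    intro T hT
    rw [Finset.mem_filter, Finset.mem_powerset] at hT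
    rw [Finset.mem_biUnion]
    exact ⟨T.card, Finset.mem_range.2 (by omega), Finset.mem_powersetCard.2 ⟨hT.1, rfl⟩⟩
  calc _ ≤ _ := Finset.card_le_card h1
    _ ≤ ∑ k ∈ Finset.range 4, (X.powersetCard k).card := Finset.card_biUnion_le
    _ ≤ ∑ k ∈ Finset.range 4, X.card ^ 3 := by
      refine Finset.sum_le_sum fun k hk => ?_
      rw [Finset.card_powersetCard]
      exact (Nat.choose_le_pow _ _).trans
        (Nat.pow_le_pow_right (by omega) (by have := Finset.mem_range.1 hk; omega))
    _ = 4 * X.card ^ 3 := by simp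
    _ ≤ X.card * X.card ^ 3 := Nat.mul_le_mul_right _ hX
    _ = X.card ^ 4 := by ring

-- The Sauer–Shelah lemma in Pajor's form: a family has at most as many members as sets it shatters.
open Classical in
theorem card_halfPlaneTraces_le (X : Finset Plane) (hX : 4 ≤ X.card) :
    (halfPlaneTraces X).card ≤ X.card ^ 4 := by
  refine (Finset.card_le_card_shatterer _).trans
    ((Finset.card_le_card ?_).trans (card_subsets_le_three X hX))
  intro T hT
  rw [Finset.mem_shatterer] at hT
  rw [Finset.mem_filter, Finset.mem_powerset]
  refine ⟨?_, card_le_three_of_shatters hT⟩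
  obtain ⟨V, hV, hTV⟩ := hT.exists_superset
  exact hTV.trans (Finset.mem_powerset.1 (Finset.mem_filter.1 hV).1)

/-! ### Rectangles as intersections of four half-planes -/

namespace PlaneRectangle

theorem eq_smul_add_smul {d₁ d₂ : Plane} (h₁ : ‖d₁‖ = 1) (h₂ : ‖d₂‖ = 1) (h : ⟪d₁, d₂⟫ = 0)
    (v : Plane) : v = ⟪d₁, v⟫ • d₁ + ⟪d₂, v⟫ • d₂ := by
  have hon : Orthonormal ℝ ![d₁, d₂] := by
    rw [orthonormal_iff_ite]
    intro i j
    fin_cases i <;> fin_cases j <;>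
      simp [h, h₁, h₂, real_inner_comm d₁ d₂ ▸ h]
  let B := basisOfOrthonormalOfCardEqFinrank hon (by simp)
  have hB : ⇑B = ![d₁, d₂] := coe_basisOfOrthonormalOfCardEqFinrank hon (by simp)
  let b := B.toOrthonormalBasis (by rw [hB]; exact hon)
  have hb : ⇑b = ![d₁, d₂] := by simp [b, hB]
  have := b.sum_repr' v
  rw [hb, Fin.sum_univ_two] at this
  simpa using this.symm

theorem mem_carrier_iff (R : PlaneRectangle) (p : Plane) :
    p ∈ R.carrier ↔ (0 ≤ ⟪R.dir₁, p - R.corner⟫ ∧ ⟪R.dir₁, p - R.corner⟫ ≤ R.width) ∧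
      (0 ≤ ⟪R.dir₂, p - R.corner⟫ ∧ ⟪R.dir₂, p - R.corner⟫ ≤ R.height) := by
  constructor
  · rintro ⟨x, hx, y, hy, rfl⟩
    have h1 : R.corner + x • R.dir₁ + y • R.dir₂ - R.corner = x • R.dir₁ + y • R.dir₂ := by abel
    rw [h1, inner_add_right, inner_add_right, inner_smul_right, inner_smul_right,
      inner_smul_right, inner_smul_right, real_inner_self_eq_norm_sq, real_inner_self_eq_norm_sq,
      R.norm_dir₁, R.norm_dir₂, R.inner_dir, real_inner_comm R.dir₁ R.dir₂, R.inner_dir]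
    simpa using ⟨hx, hy⟩
  · rintro ⟨hx, hy⟩
    refine ⟨_, hx, _, hy, ?_⟩
    rw [add_assoc, ← eq_smul_add_smul R.norm_dir₁ R.norm_dir₂ R.inner_dir]
    abel

open Classical in
/-- The points of `X` in the rectangle. -/
noncomputable def trace (R : PlaneRectangle) (X : Finset Plane) : Finset Plane :=
  X.filter (fun p => p ∈ R.carrier)

open Classical in
/-- The subsets of `X` cut out by four closed half-planes. -/
noncomputable def traces (X : Finset Plane) : Finset (Finset Plane) :=
  ((halfPlaneTraces X ×ˢ halfPlaneTraces X) ×ˢ (halfPlaneTraces X ×ˢ halfPlaneTraces X)).image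
    (fun q => (q.1.1 ∩ q.1.2) ∩ (q.2.1 ∩ q.2.2))

open Classical in
theorem card_traces_le (X : Finset Plane) (hX : 4 ≤ X.card) : (traces X).card ≤ X.card ^ 16 := by
  refine Finset.card_image_le.trans ?_
  have h := card_halfPlaneTraces_le X hX
  rw [Finset.card_product, Finset.card_product]
  calc _ ≤ (X.card ^ 4 * X.card ^ 4) * (X.card ^ 4 * X.card ^ 4) := by gcongr
    _ = _ := by ring

open Classical in
theorem filter_mem_halfPlaneTraces (X : Finset Plane) (v : Plane) (a : ℝ) :
    X.filter (fun p => ⟪v, p⟫ ≤ a) ∈ halfPlaneTraces X :=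
  Finset.mem_filter.2 ⟨Finset.mem_powerset.2 (Finset.filter_subset _ _), v, a, rfl⟩

open Classical in
theorem trace_mem_traces (R : PlaneRectangle) (X : Finset Plane) : R.trace X ∈ traces X := by
  refine Finset.mem_image.2 ⟨((X.filter (fun p => ⟪-R.dir₁, p⟫ ≤ -⟪R.dir₁, R.corner⟫),
    X.filter (fun p => ⟪R.dir₁, p⟫ ≤ R.width + ⟪R.dir₁, R.corner⟫)),
    (X.filter (fun p => ⟪-R.dir₂, p⟫ ≤ -⟪R.dir₂, R.corner⟫),
    X.filter (fun p => ⟪R.dir₂, p⟫ ≤ R.height + ⟪R.dir₂, R.corner⟫))), ?_, ?_⟩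
  · simp only [Finset.mem_product, filter_mem_halfPlaneTraces, and_self]
  · ext p
    simp only [trace, Finset.mem_inter, Finset.mem_filter, mem_carrier_iff, inner_sub_right,
      inner_neg_left, neg_le_neg_iff, sub_nonneg, sub_le_iff_le_add]
    tauto

theorem subset_of_mem_traces {X A : Finset Plane} (h : A ∈ traces X) : A ⊆ X := by
  classical
  obtain ⟨q, hq, rfl⟩ := Finset.mem_image.1 h
  simp only [Finset.mem_product] at hq
  exact (Finset.inter_subset_left.trans Finset.inter_subset_left).trans
    (Finset.mem_powerset.1 (Finset.mem_filter.1 hq.1.1).1)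

end PlaneRectangle

/-! ### General position and the surplus of an optimal rectangle -/

theorem NoThreeCollinear.mono {S X : Finset Plane} (h : NoThreeCollinear X) (hS : S ⊆ X) :
    NoThreeCollinear S :=
  fun p hp q hq r hr => h p (hS hp) q (hS hq) r (hS hr)

theorem NoThreeCollinear.card_le_two {X T : Finset Plane} (h : NoThreeCollinear X) (hT : T ⊆ X)
    {z d : Plane} (hl : ∀ p ∈ T, ∃ r : ℝ, p = z + r • d) : T.card ≤ 2 := by
  by_contra! hc
  obtain ⟨p, q, r, hp, hq, hr, hpq, hpr, hqr⟩ := Finset.two_lt_card_iff.1 hc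
  refine h p (hT hp) q (hT hq) r (hT hr) hpq hpr hqr ?_
  rw [collinear_iff_exists_forall_eq_smul_vadd]
  refine ⟨z, d, ?_⟩
  intro x hx
  have hxT : x ∈ T := by
    rcases hx with rfl | rfl | rfl <;> assumption
  obtain ⟨r, hr⟩ := hl x hxT
  exact ⟨r, by rw [hr, vadd_eq_add, add_comm]⟩

namespace PlaneRectangle

theorem mem_trace {R : PlaneRectangle} {X : Finset Plane} {p : Plane} :
    p ∈ R.trace X ↔ p ∈ X ∧ p ∈ R.carrier := by
  classical
  exact Finset.mem_filter

theorem trace_subset (R : PlaneRectangle) (X : Finset Plane) : R.trace X ⊆ X :=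
  fun _ hp => (mem_trace.1 hp).1

theorem enclosed_eq (R : PlaneRectangle) (X : Finset Plane) : R.enclosed X = (R.trace X).card :=
  rfl

theorem area_nonneg (R : PlaneRectangle) : 0 ≤ R.area :=
  mul_nonneg R.width_nonneg R.height_nonneg

/-- The same rectangle with its two sides exchanged. -/
def swap (R : PlaneRectangle) : PlaneRectangle where
  corner := R.corner
  dir₁ := R.dir₂
  dir₂ := R.dir₁
  norm_dir₁ := R.norm_dir₂
  norm_dir₂ := R.norm_dir₁
  inner_dir := by rw [real_inner_comm, R.inner_dir]
  width := R.height
  height := R.width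
  width_nonneg := R.height_nonneg
  height_nonneg := R.width_nonneg

theorem carrier_swap (R : PlaneRectangle) : R.swap.carrier = R.carrier := by
  ext p
  rw [mem_carrier_iff, mem_carrier_iff]
  exact and_comm

theorem enclosed_le_two_of_width {R : PlaneRectangle} {X : Finset Plane} (h : NoThreeCollinear X)
    (hw : R.width = 0) : R.enclosed X ≤ 2 := by
  rw [enclosed_eq]
  refine h.card_le_two (R.trace_subset X) (z := R.corner) (d := R.dir₂) ?_
  intro p hp
  obtain ⟨x, hx, y, -, rfl⟩ := (mem_trace.1 hp).2
  rw [hw] at hx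
  have : x = 0 := le_antisymm hx.2 hx.1
  exact ⟨y, by rw [this, zero_smul, add_zero]⟩

theorem enclosed_le_two {R : PlaneRectangle} {X : Finset Plane} (h : NoThreeCollinear X)
    (ha : R.area = 0) : R.enclosed X ≤ 2 := by
  rcases mul_eq_zero.1 ha with hw | hh
  · exact enclosed_le_two_of_width h hw
  · have h1 : R.swap.enclosed X ≤ 2 := enclosed_le_two_of_width h hh
    rwa [enclosed_eq, trace, carrier_swap] at h1

/-- The rectangle cut down to a smaller width. -/
def shrink (R : PlaneRectangle) (w : ℝ) (hw : 0 ≤ w) : PlaneRectangle :=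
  { R with width := w, width_nonneg := hw }

/-- The points on the far side lie on a line, so at most two are lost when that side moves in to the
farthest remaining point. -/
theorem exists_shrink (R : PlaneRectangle) {S : Finset Plane} (h : NoThreeCollinear S)
    (hw : 0 < R.width) :
    ∃ w, ∃ hw : 0 ≤ w, w < R.width ∧ R.enclosed S ≤ (R.shrink w hw).enclosed S + 2 := by
  classical
  set F := (R.trace S).filter (fun p => ⟪R.dir₁, p - R.corner⟫ < R.width) with hF
  set G := (R.trace S).filter (fun p => ¬ ⟪R.dir₁, p - R.corner⟫ < R.width) with hG
  have hcard : F.card + G.card = R.enclosed S := Finset.card_filter_add_card_filter_not _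
  have hG2 : G.card ≤ 2 := by
    refine h.card_le_two ((Finset.filter_subset _ _).trans (R.trace_subset S))
      (z := R.corner + R.width • R.dir₁) (d := R.dir₂) ?_
    intro p hp
    obtain ⟨hp1, hp2⟩ := Finset.mem_filter.1 hp
    have hp3 := (R.mem_carrier_iff p).1 (mem_trace.1 hp1).2
    have hp4 : ⟪R.dir₁, p - R.corner⟫ = R.width := le_antisymm hp3.1.2 (not_lt.1 hp2)
    refine ⟨⟪R.dir₂, p - R.corner⟫, ?_⟩
    rw [← hp4, add_assoc, ← eq_smul_add_smul R.norm_dir₁ R.norm_dir₂ R.inner_dir]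
    abel
  obtain ⟨w, hw0, hwlt, hwF⟩ : ∃ w, 0 ≤ w ∧ w < R.width ∧
      ∀ p ∈ F, ⟪R.dir₁, p - R.corner⟫ ≤ w := by
    rcases F.eq_empty_or_nonempty with hE | hE
    · exact ⟨0, le_rfl, hw, by simp [hE]⟩
    · obtain ⟨q, hq, hmax⟩ := F.exists_max_image (fun p => ⟪R.dir₁, p - R.corner⟫) hE
      obtain ⟨hq1, hq2⟩ := Finset.mem_filter.1 hq
      exact ⟨_, ((R.mem_carrier_iff q).1 (mem_trace.1 hq1).2).1.1, hq2, hmax⟩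
  refine ⟨w, hw0, hwlt, ?_⟩
  have hsub : F ⊆ (R.shrink w hw0).trace S := by
    intro p hp
    have hp1 := mem_trace.1 (Finset.mem_filter.1 hp).1
    have hp2 := (R.mem_carrier_iff p).1 hp1.2
    exact mem_trace.2 ⟨hp1.1, ((R.shrink w hw0).mem_carrier_iff p).2
      ⟨⟨hp2.1.1, hwF p hp⟩, hp2.2⟩⟩
  have := Finset.card_le_card hsub
  rw [enclosed_eq (R.shrink w hw0)]
  omega

/-- An optimal rectangle of positive area covers at most one point more than required. -/
theorem IsOptimal.enclosed_add_le {R : PlaneRectangle} {S : Finset Plane} {t : ℕ}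
    (hR : R.IsOptimal S t) (h : NoThreeCollinear S) (ha : R.area ≠ 0) :
    R.enclosed S + t ≤ S.card + 1 := by
  by_contra! hc
  have hw : 0 < R.width := lt_of_le_of_ne R.width_nonneg fun h0 => ha (by simp [area, ← h0])
  have hh : 0 < R.height := lt_of_le_of_ne R.height_nonneg fun h0 => ha (by simp [area, ← h0])
  -- A surplus of two pays for the points lost, and positive height makes the area drop strictly.
  obtain ⟨w, hw0, hlt, hle⟩ := R.exists_shrink h hw
  have h1 := hR.2 (R.shrink w hw0) (by unfold Covers; omega)
  exact absurd h1 (not_le.2 (mul_lt_mul_of_pos_right hlt hh))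

/-! ### Existence of optimal rectangles -/

/-- The width of a finite set in a direction. -/
noncomputable def extent (T : Finset Plane) (hT : T.Nonempty) (v : Plane) : ℝ :=
  T.sup' hT (fun p => ⟪v, p⟫) - T.inf' hT (fun p => ⟪v, p⟫)

theorem continuous_extent (T : Finset Plane) (hT : T.Nonempty) : Continuous (extent T hT) := by
  unfold extent
  refine Continuous.sub ?_ ?_
  · exact Continuous.finset_sup'_apply hT fun p _ => by fun_prop
  · exact Continuous.finset_inf'_apply hT fun p _ => by fun_prop

theorem extent_nonneg (T : Finset Plane) (hT : T.Nonempty) (v : Plane) : 0 ≤ extent T hT v := by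
  obtain ⟨p, hp⟩ := hT
  exact sub_nonneg.2 ((Finset.inf'_le _ hp).trans (Finset.le_sup' (fun p => ⟪v, p⟫) hp))

theorem extent_le {T : Finset Plane} (hT : T.Nonempty) {v z : Plane} {w : ℝ}
    (h : ∀ p ∈ T, 0 ≤ ⟪v, p - z⟫ ∧ ⟪v, p - z⟫ ≤ w) : extent T hT v ≤ w := by
  have h1 : T.sup' hT (fun p => ⟪v, p⟫) ≤ w + ⟪v, z⟫ := Finset.sup'_le _ _ fun p hp => by
    have := (h p hp).2
    rw [inner_sub_right] at this
    linarith
  have h2 : ⟪v, z⟫ ≤ T.inf' hT (fun p => ⟪v, p⟫) := Finset.le_inf' _ _ fun p hp => by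
    have := (h p hp).1
    rw [inner_sub_right] at this
    linarith
  unfold extent
  linarith

/-- The pairs of perpendicular unit vectors. -/
def frames : Set (Plane × Plane) :=
  {d | ‖d.1‖ = 1 ∧ ‖d.2‖ = 1 ∧ ⟪d.1, d.2⟫ = 0}

theorem isCompact_frames : IsCompact frames := by
  refine Metric.isCompact_of_isClosed_isBounded ?_ ?_
  · refine (isClosed_eq (by fun_prop) continuous_const).inter
      ((isClosed_eq (by fun_prop) continuous_const).inter
        (isClosed_eq (by fun_prop) continuous_const))
  · refine (Metric.isBounded_closedBall (x := (0 : Plane × Plane)) (r := 1)).subset ?_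
    rintro ⟨d₁, d₂⟩ ⟨h1, h2, -⟩
    rw [mem_closedBall_zero_iff, Prod.norm_def]
    exact max_le h1.le h2.le

theorem frames_nonempty : frames.Nonempty := by
  let b := EuclideanSpace.basisFun (Fin 2) ℝ
  exact ⟨(b 0, b 1), b.orthonormal.1 0, b.orthonormal.1 1, b.orthonormal.2 (by decide)⟩

/-- The smallest rectangle around `T` with sides in the given directions. -/
noncomputable def bounding (T : Finset Plane) (hT : T.Nonempty) (d : Plane × Plane)
    (hd : d ∈ frames) : PlaneRectangle where
  corner := T.inf' hT (fun p => ⟪d.1, p⟫) • d.1 + T.inf' hT (fun p => ⟪d.2, p⟫) • d.2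
  dir₁ := d.1
  dir₂ := d.2
  norm_dir₁ := hd.1
  norm_dir₂ := hd.2.1
  inner_dir := hd.2.2
  width := extent T hT d.1
  height := extent T hT d.2
  width_nonneg := extent_nonneg T hT d.1
  height_nonneg := extent_nonneg T hT d.2

theorem mem_carrier_bounding {T : Finset Plane} (hT : T.Nonempty) {d : Plane × Plane}
    (hd : d ∈ frames) {p : Plane} (hp : p ∈ T) : p ∈ (bounding T hT d hd).carrier := by
  have hcomm : ⟪d.2, d.1⟫ = 0 := by rw [real_inner_comm, hd.2.2]
  have hbd : ∀ v : Plane, 0 ≤ ⟪v, p⟫ - T.inf' hT (fun p => ⟪v, p⟫) ∧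
      ⟪v, p⟫ - T.inf' hT (fun p => ⟪v, p⟫) ≤ extent T hT v := fun v =>
    ⟨sub_nonneg.2 (Finset.inf'_le _ hp),
      sub_le_sub_right (Finset.le_sup' (fun p => ⟪v, p⟫) hp) _⟩
  rw [mem_carrier_iff]
  simp only [bounding, inner_sub_right, inner_add_right, inner_smul_right,
    real_inner_self_eq_norm_sq, hd.1, hd.2.1, hd.2.2, hcomm, one_pow, mul_one, mul_zero, add_zero,
    zero_add]
  exact ⟨hbd d.1, hbd d.2⟩

/-- A nonempty finite set has an enclosing rectangle of minimum area. -/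
theorem exists_min_area_enclosing (T : Finset Plane) (hT : T.Nonempty) :
    ∃ R : PlaneRectangle, (∀ p ∈ T, p ∈ R.carrier) ∧
      ∀ R' : PlaneRectangle, (∀ p ∈ T, p ∈ R'.carrier) → R.area ≤ R'.area := by
  -- For fixed directions the bounding box is best, and its area depends continuously on the frame.
  obtain ⟨d, hd, hmin⟩ := isCompact_frames.exists_isMinOn frames_nonempty
    (f := fun d : Plane × Plane => extent T hT d.1 * extent T hT d.2)
    (((continuous_extent T hT).comp continuous_fst).mul
      ((continuous_extent T hT).comp continuous_snd)).continuousOn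
  refine ⟨bounding T hT d hd, fun p hp => mem_carrier_bounding hT hd hp, fun R' hR' => ?_⟩
  have h1 : extent T hT R'.dir₁ ≤ R'.width :=
    extent_le hT fun p hp => ((R'.mem_carrier_iff p).1 (hR' p hp)).1
  have h2 : extent T hT R'.dir₂ ≤ R'.height :=
    extent_le hT fun p hp => ((R'.mem_carrier_iff p).1 (hR' p hp)).2
  have h3 := hmin (show (R'.dir₁, R'.dir₂) ∈ frames from
    ⟨R'.norm_dir₁, R'.norm_dir₂, R'.inner_dir⟩)
  exact le_trans h3 (mul_le_mul h1 h2 (extent_nonneg _ _ _) R'.width_nonneg)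

theorem exists_area_eq_zero : ∃ R : PlaneRectangle, R.area = 0 := by
  obtain ⟨d, hd⟩ := frames_nonempty
  exact ⟨⟨0, d.1, d.2, hd.1, hd.2.1, hd.2.2, 0, 0, le_rfl, le_rfl⟩, zero_mul _⟩

/-- Only finitely many subsets of `S` can be the covered set, so the best of their minimum enclosing
rectangles is optimal. If `t` reaches `|S|`, any rectangle of area zero will do. -/
theorem exists_isOptimal (S : Finset Plane) (t : ℕ) : ∃ R : PlaneRectangle, R.IsOptimal S t := by
  classical
  by_cases hts : S.card ≤ t
  · obtain ⟨R, hR⟩ := exists_area_eq_zero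
    exact ⟨R, hts.trans (Nat.le_add_left _ _), fun R' _ => hR.trans_le R'.area_nonneg⟩
  have hne : ∀ T : {T : Finset Plane // T ⊆ S ∧ S.card ≤ T.card + t}, T.1.Nonempty := by
    rintro ⟨T, -, hT⟩
    rw [← Finset.card_pos]
    dsimp only
    omega
  choose R hR hmin using fun T : {T : Finset Plane // T ⊆ S ∧ S.card ≤ T.card + t} =>
    exists_min_area_enclosing T.1 (hne T)
  have : Finite {T : Finset Plane // T ⊆ S ∧ S.card ≤ T.card + t} :=
    Set.Finite.subset S.powerset.finite_toSet fun T hT => Finset.mem_coe.2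
      (Finset.mem_powerset.2 hT.1)
  have : Nonempty {T : Finset Plane // T ⊆ S ∧ S.card ≤ T.card + t} :=
    ⟨⟨S, subset_rfl, Nat.le_add_right _ _⟩⟩
  obtain ⟨T, hT⟩ := Finite.exists_min (fun T => (R T).area)
  refine ⟨R T, ?_, fun R' hR' => ?_⟩
  · refine T.2.2.trans (Nat.add_le_add_right (Finset.card_le_card fun p hp => ?_) t)
    exact mem_trace.2 ⟨T.2.1 hp, hR T p hp⟩
  · exact (hT ⟨R'.trace S, R'.trace_subset S, hR'⟩).trans
      (hmin _ R' fun p hp => (mem_trace.1 hp).2)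

end PlaneRectangle

/-! ### Union bound over a family of sets -/

theorem sampleProb_eq_one {α : Type*} {X : Finset α} {s : ℕ} {E : Finset α → Prop}
    (hs : s ≤ X.card) (h : ∀ S ∈ X.powersetCard s, E S) : sampleProb X s E = 1 := by
  classical
  unfold sampleProb
  rw [Finset.filter_true_of_mem h]
  refine div_self ?_
  rw [Finset.card_powersetCard]
  exact_mod_cast (Nat.choose_pos hs).ne'

/-- With high probability, a random sample approximates the relative size of every member of a
family of sets. -/
theorem le_sampleProb_of_approximation {α : Type*} [DecidableEq α] {X : Finset α} {s : ℕ}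
    {E : Finset α → Prop} (hX : 0 < X.card) (hs : s ≤ X.card) (F : Finset (Finset α))
    (hF : ∀ A ∈ F, A ⊆ X) {δ : ℝ} (hδ : 0 ≤ δ)
    (h : ∀ S ∈ X.powersetCard s,
      (∀ A ∈ F, |((S ∩ A).card : ℝ) - (A.card : ℝ) / X.card * s| ≤ δ * s) → E S) :
    1 - 2 * F.card * Real.exp (-(δ ^ 2 * s / 4)) ≤ sampleProb X s E := by
  classical
  set e := Real.exp (-(δ ^ 2 * s / 4)) with he
  have hN : (0 : ℝ) < X.card.choose s := by exact_mod_cast Nat.choose_pos hs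
  let bad : Finset α → Finset (Finset α) := fun A => (X.powersetCard s).filter
    (fun S => ((A.card : ℝ) / X.card + δ) * s < ((S ∩ A).card : ℝ))
  have hbad : ∀ A ⊆ X, ((bad A).card : ℝ) ≤ X.card.choose s * e := fun A hA =>
    card_upper_tail_le X A s hA hX hδ
  have hcov : (X.powersetCard s).filter (fun S => ¬ E S)
      ⊆ F.biUnion (fun A => bad A ∪ bad (X \ A)) := by
    intro S hS
    obtain ⟨hS1, hS2⟩ := Finset.mem_filter.1 hS
    have h1 := mt (h S hS1) hS2
    push Not at h1
    obtain ⟨A, hA, hlt⟩ := h1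
    refine Finset.mem_biUnion.2 ⟨A, hA, Finset.mem_union.2 ?_⟩
    rcases lt_abs.1 hlt with h2 | h2
    · exact Or.inl (Finset.mem_filter.2 ⟨hS1, by linarith⟩)
    -- Too few points in `A` means too many in the complement, so the upper tail bound suffices.
    · refine Or.inr (Finset.mem_filter.2 ⟨hS1, ?_⟩)
      obtain ⟨hSX, hSc⟩ := Finset.mem_powersetCard.1 hS1
      have h3 : (S ∩ A).card + (S ∩ (X \ A)).card = s := by
        rw [← hSc, ← Finset.card_inter_add_card_sdiff S A]
        congr 2
        ext p
        simp only [Finset.mem_inter, Finset.mem_sdiff]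
        exact ⟨fun hp => ⟨hp.1, hp.2.2⟩, fun hp => ⟨hp.1, hSX hp.1, hp.2⟩⟩
      have h4 : ((X \ A).card : ℝ) = X.card - A.card := by
        rw [Finset.card_sdiff_of_subset (hF A hA), Nat.cast_sub (Finset.card_le_card (hF A hA))]
      have h5 : ((S ∩ A).card : ℝ) + (S ∩ (X \ A)).card = s := by exact_mod_cast h3
      rw [h4, sub_div, div_self (by positivity)]
      linarith
  have hcard : (((X.powersetCard s).filter (fun S => ¬ E S)).card : ℝ)
      ≤ F.card * (2 * (X.card.choose s * e)) := by
    calc _ ≤ ((F.biUnion (fun A => bad A ∪ bad (X \ A))).card : ℝ) := by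
          exact_mod_cast Finset.card_le_card hcov
      _ ≤ ((∑ A ∈ F, ((bad A).card + (bad (X \ A)).card) : ℕ) : ℝ) := by
          exact_mod_cast Finset.card_biUnion_le.trans
            (Finset.sum_le_sum fun A _ => Finset.card_union_le _ _)
      _ = ∑ A ∈ F, (((bad A).card : ℝ) + (bad (X \ A)).card) := by push_cast; rfl
      _ ≤ ∑ A ∈ F, 2 * (X.card.choose s * e) := Finset.sum_le_sum fun A hA => by
          linarith [hbad A (hF A hA), hbad (X \ A) Finset.sdiff_subset]
      _ = _ := by rw [Finset.sum_const, nsmul_eq_mul]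
  have hsum : (((X.powersetCard s).filter E).card : ℝ)
      + ((X.powersetCard s).filter (fun S => ¬ E S)).card = X.card.choose s := by
    rw [← Finset.card_powersetCard s X]
    exact_mod_cast Finset.card_filter_add_card_filter_not (s := X.powersetCard s) E
  unfold sampleProb
  rw [Finset.card_powersetCard, le_div_iff₀ hN]
  have hfin : (X.card.choose s : ℝ) - F.card * (2 * (X.card.choose s * e))
      ≤ ((X.powersetCard s).filter E).card := by linarith
  calc _ = (X.card.choose s : ℝ) - F.card * (2 * (X.card.choose s * e)) := by ring
    _ ≤ _ := by convert hfin

/-! ### From the sample to the whole set -/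

namespace PlaneRectangle

theorem trace_of_subset (R : PlaneRectangle) {S X : Finset Plane} [DecidableEq Plane]
    (hS : S ⊆ X) : R.trace S = S ∩ R.trace X := by
  ext p
  rw [Finset.mem_inter, mem_trace, mem_trace]
  exact ⟨fun hp => ⟨hp.1, hS hp.1, hp.2⟩, fun hp => ⟨hp.1, hp.2.2⟩⟩

/-- An optimal rectangle for a sample that approximates all rectangles is nearly optimal for the
whole set. -/
theorem IsOptimal.enclosed_bounds {R : PlaneRectangle} {S X : Finset Plane} {n t s t' : ℕ}
    {θ ε κ : ℝ} (hR : R.IsOptimal S t') (hX : NoThreeCollinear X) (hS : S ⊆ X) (hs : S.card = s)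
    (hn : 4 ≤ n) (hs0 : 0 < s) (ht : (t : ℝ) ≤ (n : ℝ) / 2) (hε : 0 < ε)
    (hκ₁ : κ ≤ (1 - θ) / 2) (hκ₂ : κ ≤ θ / 4) (hθ₀ : 0 < θ) (hθ₁ : θ < 1)
    (ht' : (t' : ℝ) = ((t : ℝ) / n + θ * ε - θ * ε * t / n) * s)
    (hsl : θ * ε < 1 → 1 ≤ θ * ε / 4 * s)
    (happ : |(R.enclosed S : ℝ) - (R.enclosed X : ℝ) / n * s| ≤ κ * ε * s) :
    ((n : ℝ) - t) * (1 - ε) ≤ (R.enclosed X : ℝ) ∧ (R.enclosed X : ℝ) ≤ (n : ℝ) - t + 1 := by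
  have hn0 : (0 : ℝ) < n := by exact_mod_cast (by omega : 0 < n)
  have hn4 : (4 : ℝ) ≤ n := by exact_mod_cast hn
  have hs0' : (0 : ℝ) < s := by exact_mod_cast hs0
  set u : ℝ := (t : ℝ) / n with hu
  set a : ℝ := (R.enclosed X : ℝ) / n with ha
  have htu : (t : ℝ) = u * n := by rw [hu]; field_simp
  have hau : (R.enclosed X : ℝ) = a * n := by rw [ha]; field_simp
  have hu2 : u ≤ 1 / 2 := by rw [hu, div_le_iff₀ hn0]; linarith
  have ht'' : (t' : ℝ) = (u + θ * ε * (1 - u)) * s := by rw [ht', hu]; ring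
  obtain ⟨happ1, happ2⟩ := abs_le.1 happ
  constructor
  · have hcov : (s : ℝ) ≤ R.enclosed S + t' := by
      have := hR.1
      unfold Covers at this
      rw [hs] at this
      exact_mod_cast this
    have h1 : ((1 - u) * (1 - θ * ε) - κ * ε) * s ≤ a * s := by
      rw [ht''] at hcov
      linarith
    have h2 := le_of_mul_le_mul_right h1 hs0'
    -- The error fits between `(1 - u) * (1 - θ * ε)` and `(1 - u) * (1 - ε)` because `1 - u ≥ 1 /
    -- 2`.
    have h3 : κ * ε ≤ (1 - u) * ((1 - θ) * ε) := by
      have h4 : κ * ε ≤ (1 - θ) / 2 * ε := mul_le_mul_of_nonneg_right hκ₁ hε.le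
      have := mul_le_mul_of_nonneg_right (show 1 / 2 ≤ 1 - u by linarith)
        (mul_nonneg (sub_nonneg.2 hθ₁.le) hε.le)
      linarith
    rw [htu, hau]
    have h5 : (1 - u) * (1 - ε) ≤ a := by linarith
    calc _ = (1 - u) * (1 - ε) * n := by ring
      _ ≤ _ := mul_le_mul_of_nonneg_right h5 hn0.le
  · by_cases harea : R.area = 0
    · have : (R.enclosed X : ℝ) ≤ 2 := by exact_mod_cast enclosed_le_two hX harea
      linarith
    · have hle : (R.enclosed S : ℝ) + t' ≤ s + 1 := by
        have := hR.enclosed_add_le (hX.mono hS) harea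
        rw [hs] at this
        exact_mod_cast this
      -- Otherwise covering nothing is allowed and the optimum has area zero. This excludes `θ * ε ≥
      -- 1`.
      have hts : (t' : ℝ) < s := by
        by_contra! hts
        have hts' : s ≤ t' := by exact_mod_cast hts
        obtain ⟨R', hR'⟩ := exists_area_eq_zero
        have h1 := hR.2 R' (by unfold Covers; omega)
        exact harea (le_antisymm (h1.trans_eq hR') R.area_nonneg)
      have hθε : θ * ε < 1 := by
        by_contra! hθε
        rw [ht''] at hts
        have : (1 : ℝ) ≤ u + θ * ε * (1 - u) := by
          have := mul_le_mul_of_nonneg_right hθε (show 0 ≤ 1 - u by linarith)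
          linarith
        have := mul_le_mul_of_nonneg_right this hs0'.le
        linarith
      have h1 := hsl hθε
      -- The margin `θ * ε * (1 - u) * s` is at least `θ * ε * s / 2`: one half of this absorbs the
      -- error `κ * ε * s`, the other the surplus point.
      have h2 : a * s ≤ (1 - u) * s := by
        have h3 : κ * ε * s ≤ θ / 4 * ε * s := by gcongr
        have h4 : 1 / 2 * (θ * ε * s) ≤ (1 - u) * (θ * ε * s) :=
          mul_le_mul_of_nonneg_right (by linarith) (by positivity)
        rw [ht''] at hle
        linarith
      have h5 := mul_le_mul_of_nonneg_right (le_of_mul_le_mul_right h2 hs0') hn0.le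
      rw [htu, hau]
      linarith

/-- The bounds for the sample that consists of all points. -/
theorem IsOptimal.enclosed_bounds_self {R : PlaneRectangle} {X : Finset Plane} {n t t' : ℕ}
    {θ ε : ℝ} (hR : R.IsOptimal X t') (hX : NoThreeCollinear X) (hn : n = X.card)
    (hn4 : 4 ≤ n) (ht : (t : ℝ) ≤ (n : ℝ) / 2) (hε : 0 < ε) (hθ₀ : 0 < θ) (hθ₁ : θ < 1)
    (ht' : (t' : ℝ) = ((t : ℝ) / n + θ * ε - θ * ε * t / n) * n) :
    ((n : ℝ) - t) * (1 - ε) ≤ (R.enclosed X : ℝ) ∧ (R.enclosed X : ℝ) ≤ (n : ℝ) - t + 1 := by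
  have hn4' : (4 : ℝ) ≤ n := by exact_mod_cast hn4
  have hn0 : (n : ℝ) ≠ 0 := by positivity
  have ht'' : (t' : ℝ) = t + θ * ε * (n - t) := by rw [ht']; field_simp; ring
  have hnt : (0 : ℝ) ≤ n - t := by linarith
  constructor
  · have hcov : (n : ℝ) ≤ R.enclosed X + t' := by
      have := hR.1
      unfold Covers at this
      rw [← hn] at this
      exact_mod_cast this
    have h1 : θ * (ε * (n - t)) ≤ 1 * (ε * (n - t)) :=
      mul_le_mul_of_nonneg_right hθ₁.le (by positivity)
    rw [ht''] at hcov
    linarith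
  · by_cases harea : R.area = 0
    · have : (R.enclosed X : ℝ) ≤ 2 := by exact_mod_cast enclosed_le_two hX harea
      linarith
    · have hle : (R.enclosed X : ℝ) + t' ≤ n + 1 := by
        have := hR.enclosed_add_le hX harea
        rw [← hn] at this
        exact_mod_cast this
      have : 0 ≤ θ * ε * (n - t) := by positivity
      linarith

end PlaneRectangle

/-! ### Choice of constants and conclusion -/

theorem two_mul_pow_mul_exp_le {n : ℕ} (hn : 4 ≤ n) {x : ℝ} (hx : 18 * Real.log n ≤ x) :
    2 * (n : ℝ) ^ 16 * Real.exp (-x) ≤ 3 / n := by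
  have hn1 : (1 : ℝ) ≤ n := by exact_mod_cast (by omega : 1 ≤ n)
  have hn0 : (0 : ℝ) < n := by linarith
  have h1 : Real.exp (-x) ≤ ((n : ℝ) ^ 18)⁻¹ := by
    rw [Real.exp_neg]
    refine inv_anti₀ (by positivity) ?_
    calc (n : ℝ) ^ 18 = Real.exp ((18 : ℕ) * Real.log n) := by
          rw [Real.exp_nat_mul, Real.exp_log hn0]
      _ ≤ Real.exp x := Real.exp_le_exp.2 (by exact_mod_cast hx)
  calc 2 * (n : ℝ) ^ 16 * Real.exp (-x) ≤ 2 * (n : ℝ) ^ 16 * ((n : ℝ) ^ 18)⁻¹ := by gcongr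
    _ = (2 : ℝ) / n / n := by field_simp
    _ ≤ (2 : ℝ) / n := div_le_self (by positivity) hn1
    _ ≤ (3 : ℝ) / n := by gcongr; norm_num

open PlaneRectangle in
theorem mainTheorem3 (θ : ℝ) (hθ₀ : 0 < θ) (hθ₁ : θ < 1) :
    ∃ c : ℝ, 0 < c ∧
      ∀ (X : Finset Plane) (n t s t' : ℕ) (ε : ℝ),
        NoThreeCollinear X →
        n = X.card →
        (t : ℝ) ≤ (n : ℝ) / 2 →
        0 < ε →
        s = sampleSize c ε n →
        (t' : ℝ) = ((t : ℝ) / n + θ * ε - θ * ε * t / n) * s →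
        1 - 3 / (n : ℝ) ≤ sampleProb X s (fun S =>
          (∃ R : PlaneRectangle, R.IsOptimal S t') ∧
          ∀ R : PlaneRectangle, R.IsOptimal S t' →
            ((n : ℝ) - t) * (1 - ε) ≤ (R.enclosed X : ℝ) ∧
            (R.enclosed X : ℝ) ≤ (n : ℝ) - t + 1) := by
  classical
  obtain ⟨κ, hκ0, hκ₁, hκ₂⟩ : ∃ κ : ℝ, 0 < κ ∧ κ ≤ (1 - θ) / 2 ∧ κ ≤ θ / 4 :=
    ⟨min ((1 - θ) / 2) (θ / 4), lt_min (by linarith) (by linarith), min_le_left _ _,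
      min_le_right _ _⟩
  -- `4 / θ ^ 2` makes the margin exceed the surplus point; `72 / κ ^ 2 = 4 * 18 / κ ^ 2` gives
  -- failure probability `exp (-18 * log n)` per tail, against `n ^ 16` traces.
  obtain ⟨c, hc0, hc₁, hc₂⟩ : ∃ c : ℝ, 0 < c ∧ 4 / θ ^ 2 ≤ c ∧ 72 / κ ^ 2 ≤ c :=
    ⟨max (4 / θ ^ 2) (72 / κ ^ 2), lt_max_of_lt_left (by positivity), le_max_left _ _,
      le_max_right _ _⟩
  refine ⟨c, hc0, ?_⟩
  intro X n t s t' ε hX hn ht hε hs ht'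
  have hsn : s ≤ n := hs.trans_le (min_le_left _ _)
  by_cases hn4 : 4 ≤ n
  swap
  -- For `1 ≤ n ≤ 3` the probability bound is trivial. For `n = 0`, where `3 / 0 = 0`, the event
  -- must be certain.
  · rcases Nat.eq_zero_or_pos n with rfl | hpos
    · rw [Finset.card_eq_zero.1 hn.symm, sampleProb_eq_one (by simpa using hsn)]
      · simp
      · intro S _
        refine ⟨exists_isOptimal S t', fun R _ => ?_⟩
        have h0 : (t : ℝ) = 0 := le_antisymm (by simpa using ht) (by positivity)
        simp [h0, enclosed]
    · have h1 : (n : ℝ) ≤ 3 := by exact_mod_cast (by omega : n ≤ 3)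
      have h2 : (1 : ℝ) ≤ 3 / n := by
        rw [le_div_iff₀ (by exact_mod_cast hpos)]
        linarith
      have h3 : 0 ≤ sampleProb X s (fun S => (∃ R : PlaneRectangle, R.IsOptimal S t') ∧
          ∀ R : PlaneRectangle, R.IsOptimal S t' →
            ((n : ℝ) - t) * (1 - ε) ≤ (R.enclosed X : ℝ) ∧
            (R.enclosed X : ℝ) ≤ (n : ℝ) - t + 1) := by
        unfold sampleProb
        positivity
      linarith
  have hn0 : (0 : ℝ) < n := by exact_mod_cast (by omega : 0 < n)
  -- If the minimum is `n`, the sample is all of `X` and the size may fall short of `c * ε⁻² * log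
  -- n`; exact counting replaces approximation, and the surplus point becomes the `+ 1` of the
  -- bound.
  rcases hsn.eq_or_lt with hseq | hslt
  · subst hseq
    rw [sampleProb_eq_one hn.le]
    · linarith [show (0 : ℝ) ≤ 3 / s by positivity]
    · intro S hS
      rw [hn, Finset.powersetCard_self, Finset.mem_singleton] at hS
      subst hS
      exact ⟨exists_isOptimal S t', fun R hR =>
        hR.enclosed_bounds_self hX hn hn4 ht hε hθ₀ hθ₁ ht'⟩
  have hlog : 1 ≤ Real.log n := by
    rw [Real.le_log_iff_exp_le hn0]
    have h4 : (4 : ℝ) ≤ n := by exact_mod_cast hn4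
    linarith [Real.exp_one_lt_d9]
  have hsc : c * (ε ^ 2)⁻¹ * Real.log n ≤ s := by
    have h1 : s = ⌈c * (ε ^ 2)⁻¹ * Real.log n⌉₊ := by
      rw [hs, sampleSize] at hslt ⊢
      exact min_eq_right (by omega)
    rw [h1]
    exact Nat.le_ceil _
  have hεs : c * Real.log n ≤ ε ^ 2 * s := by
    have h1 := mul_le_mul_of_nonneg_left hsc (sq_nonneg ε)
    rwa [show ε ^ 2 * (c * (ε ^ 2)⁻¹ * Real.log n) = c * Real.log n by field_simp] at h1
  have hs0 : 0 < s := by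
    have : (0 : ℝ) < s := lt_of_lt_of_le (by positivity) hsc
    exact_mod_cast this
  have hsl : θ * ε < 1 → 1 ≤ θ * ε / 4 * s := by
    intro hθε
    have h1 : 4 ≤ θ ^ 2 * c := by
      rwa [div_le_iff₀' (by positivity)] at hc₁
    have h2 : θ ^ 2 * c * 1 ≤ θ ^ 2 * c * Real.log n := by gcongr
    have h3 : θ ^ 2 * (c * Real.log n) ≤ θ ^ 2 * (ε ^ 2 * s) := by gcongr
    have h4 : θ * ε * (θ * ε * s) ≤ 1 * (θ * ε * s) := by gcongr
    linarith
  have hx : 18 * Real.log n ≤ (κ * ε) ^ 2 * s / 4 := by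
    have h1 : 72 ≤ κ ^ 2 * c := by
      rwa [div_le_iff₀' (by positivity)] at hc₂
    have h2 : 72 * Real.log n ≤ κ ^ 2 * c * Real.log n := by gcongr
    have h3 : κ ^ 2 * (c * Real.log n) ≤ κ ^ 2 * (ε ^ 2 * s) := by gcongr
    linarith
  have hprob := le_sampleProb_of_approximation (X := X) (s := s) (by omega) (by omega)
    (traces X) (fun A hA => subset_of_mem_traces hA) (δ := κ * ε) (by positivity)
    (E := fun S => (∃ R : PlaneRectangle, R.IsOptimal S t') ∧
          ∀ R : PlaneRectangle, R.IsOptimal S t' →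
            ((n : ℝ) - t) * (1 - ε) ≤ (R.enclosed X : ℝ) ∧
            (R.enclosed X : ℝ) ≤ (n : ℝ) - t + 1) (by
      intro S hS happ
      obtain ⟨hSX, hSc⟩ := Finset.mem_powersetCard.1 hS
      refine ⟨exists_isOptimal S t', fun R hR => ?_⟩
      refine hR.enclosed_bounds hX hSX hSc hn4 hs0 ht hε hκ₁ hκ₂ hθ₀ hθ₁ ht' hsl ?_
      have h1 := happ _ (R.trace_mem_traces X)
      rwa [← R.trace_of_subset hSX, ← enclosed_eq, ← enclosed_eq, ← hn] at h1)
  refine le_trans ?_ hprob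
  have h1 : ((traces X).card : ℝ) ≤ (n : ℝ) ^ 16 := by
    rw [hn]
    exact_mod_cast card_traces_le X (by omega)
  have h2 := two_mul_pow_mul_exp_le hn4 hx
  have h3 : 2 * ((traces X).card : ℝ) * Real.exp (-((κ * ε) ^ 2 * s / 4))
      ≤ 2 * (n : ℝ) ^ 16 * Real.exp (-((κ * ε) ^ 2 * s / 4)) := by gcongr
  linarith
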